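/- Let $G$ be a finite simple graph with vertex set $V$, let $K$ be a field, let $R=K[x\mid x\in V]$ (vertices are identified with variables), and let $I=I(G)\subset R$ be the edge ideal of $G$, generated by the products $xy$ over all edges $xy$ of $G$. Write $N(x)$ for the set of neighbors of $x$ in $G$. Let $t$ be a non-negative integer and let $\mathfrak p\in \mathrm{Ass}(R/I^t)$. (If $t=0$ there is no such $\mathfrak p$.) Associated primes of powers of $I$ are generated by variables; such a prime is identified with the set of variables in it. Let $\mathfrak p_a$ be the set of variables that divide some minimal monomial generator of degree two of the localization $I_{\mathfrak p}=IR_{\mathfrak p}$. Put $N_1=\bigcup_{x\in\mathfrak p_a}N(x)$, $\mathfrak p_1=\mathfrak p_a\cup N_1$ and $N_2=\bigl(\bigcup_{x\in\mathfrak p_1}N(x)\bigr)\setminus\mathfrak p$. Let $G_1$ be the induced subgraph of $G$ on $\mathfrak p_1\cup N_2$, and let $I_1\subset R$ be the ideal generated by the products $xy$ over the edges $xy$ of $G_1$. Assume that $(\mathfrak p_1)R=(I_1^t:c)$ for some monomial $c\in K[x\mid x\in \mathfrak p_a]$ of degree at most $2t-1$. Let $x\in\mathfrak p_1$, let $\mathfrak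 p_1'=\mathfrak p_1\cup N(x)$, and let $\mathfrak p_2'$ be any minimal vertex cover of $G_2'$, where $G_2'$ is the induced subgraph of $G$ on $V\setminus\mathfrak p_1'$. Then the ideal $\mathfrak p'=(\mathfrak p_1',\mathfrak p_2')$ of $R$ generated by the variables in $\mathfrak p_1'\cup\mathfrak p_2'$ satisfies $\mathfrak p'\in\mathrm{Ass}(R/I^{t+1})$. -/

import Mathlib

namespace BuildOutward

/-- The edge ideal of a graph `G` on `V`: the ideal of `K[x_v : v ∈ V]` generated by the
products `x_u x_v` over the edges `uv` of `G`. -/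
noncomputable def edgeIdeal (K : Type*) [Field K] {V : Type*} (G : SimpleGraph V) :
    Ideal (MvPolynomial V K) :=
  Ideal.span {f | ∃ u v : V, G.Adj u v ∧ f = MvPolynomial.X u * MvPolynomial.X v}

/-- The induced subgraph of `G` on the vertices in `W`, viewed as a graph on `V` (the vertices
outside `W` are isolated), so that its edge ideal is formed in the ring of `G`. -/
def inducedOn {V : Type*} (G : SimpleGraph V) (W : Set V) : SimpleGraph V :=
  (G.induce W).spanningCoe

/-- The union of the neighbor sets `N(x)`, for `x ∈ A`. -/
def nbhd {V : Type*} (G : SimpleGraph V) (A : Set V) : Set V :=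
  ⋃ x ∈ A, G.neighborSet x

/-- The ideal of `K[x_v : v ∈ V]` generated by the variables in `A`. -/
noncomputable def varIdeal (K : Type*) [Field K] {V : Type*} (A : Set V) : Ideal (MvPolynomial V K) :=
  Ideal.span (MvPolynomial.X '' A)

/-- The variables lying in an ideal. -/
def vars {K : Type*} [Field K] {V : Type*} (p : Ideal (MvPolynomial V K)) : Set V :=
  {v | MvPolynomial.X v ∈ p}

/-- `m` is the exponent of a minimal monomial generator of the localization `I R_p`: the
monomial `x^m` lies in `I R_p`, and no proper divisor of it does. -/
def IsLocalGenerator {K : Type*} [Field K] {V : Type*} (I p : Ideal (MvPolynomial V K))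
    [p.IsPrime] (m : V →₀ ℕ) : Prop :=
  Minimal (fun e : V →₀ ℕ =>
    algebraMap (MvPolynomial V K) (Localization.AtPrime p) (MvPolynomial.monomial e 1) ∈
      I.map (algebraMap (MvPolynomial V K) (Localization.AtPrime p))) m

section Decomposition

variable {K : Type*} [Field K] {V : Type*} (G : SimpleGraph V) (p : Ideal (MvPolynomial V K))
  [p.IsPrime]

/-- `p_a`: the variables that occur in a generator of degree two of the localization at `p` of
the edge ideal of `G`. -/
def partA : Set V :=
  {v | ∃ m : V →₀ ℕ, IsLocalGenerator (edgeIdeal K G) p m ∧ m.degree = 2 ∧ v ∈ m.support}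

/-- `p_1 = p_a ∪ N_1`, where `N_1` is the union of the neighbor sets of the vertices in `p_a`. -/
def partOne : Set V := partA G p ∪ nbhd G (partA G p)

/-- `N_2`: the neighbors of the vertices in `p_1` that are not in `p`. -/
def outerNbhd : Set V := nbhd G (partOne G p) \ vars p

/-- `G_1`: the induced subgraph of `G` on `p_1 ∪ N_2`. -/
def graphOne : SimpleGraph V := inducedOn G (partOne G p ∪ outerNbhd G p)

end Decomposition

end BuildOutward

namespace BuildOutward

open MvPolynomial

/-! ### Edge ideal powers, ideals of variables and their colon ideals. -/

section Generic

variable {K : Type*} [Field K] {V : Type*}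

/-! Choose a neighbor `y` of `x` in `p_a`, and let `M` be the product of the variables outside `P =
p₁' ∪ p₂'`. Then `P` generates `I^(t+1) : c·x·y·M`. A variable of `P` lies in this colon ideal
because `c` times any variable of `p_1` is in `I^t`, and one further edge remains: `xy`, an edge at
`x`, or an edge from `p₂'` to a factor of `M`. Conversely, multiply `c·x·y·M` by a monomial `u`
avoiding `P`. Since `P` is a vertex cover containing every neighbor of the support of `c·x·y`, a
product of edges dividing the result must divide `c·x·y`. Its degree is at most `2t + 1`, too small
for `t + 1` edges. -/

/-- The exponents of the products of `n` edges of `G`. -/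
def edgeSums (G : SimpleGraph V) : ℕ → Set (V →₀ ℕ)
  | 0 => {0}
  | n + 1 => {d | ∃ e ∈ edgeSums G n, ∃ u v : V, G.Adj u v ∧
      d = e + (Finsupp.single u 1 + Finsupp.single v 1)}

theorem edgeIdeal_pow_eq_span (G : SimpleGraph V) (n : ℕ) :
    edgeIdeal K G ^ n = Ideal.span ((fun s => monomial s (1 : K)) '' edgeSums G n) := by
  induction n with
  | zero => simp [edgeSums]
  | succ n ih =>
    rw [pow_succ, ih, edgeIdeal, Ideal.span_mul_span']
    congr 1
    ext f
    simp only [Set.mem_mul, Set.mem_image, edgeSums, Set.mem_ofPred_eq]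
    constructor
    · rintro ⟨_, ⟨e, he, rfl⟩, _, ⟨u, v, huv, rfl⟩, rfl⟩
      exact ⟨_, ⟨e, he, u, v, huv, rfl⟩, by simp [X, monomial_mul]⟩
    · rintro ⟨_, ⟨e, he, u, v, huv, rfl⟩, rfl⟩
      exact ⟨_, ⟨e, he, rfl⟩, _, ⟨u, v, huv, rfl⟩, by simp [X, monomial_mul]⟩

theorem degree_of_mem_edgeSums {G : SimpleGraph V} {n : ℕ} {d : V →₀ ℕ}
    (hd : d ∈ edgeSums G n) : d.degree = 2 * n := by
  induction n generalizing d with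
  | zero => simp_all [edgeSums]
  | succ n ih =>
    obtain ⟨e, he, u, v, -, rfl⟩ := hd
    simp only [map_add, ih he, Finsupp.degree_single]
    ring

/-- If every edge inside `S` lies inside `W`, then a product of edges supported in `S` is
supported in `W`. -/
theorem support_subset_of_mem_edgeSums {G : SimpleGraph V} {S W : Set V}
    (h : ∀ ⦃a b⦄, G.Adj a b → a ∈ S → b ∈ S → a ∈ W) {n : ℕ} {d : V →₀ ℕ}
    (hd : d ∈ edgeSums G n) (hS : ∀ v, d v ≠ 0 → v ∈ S) : ∀ v, d v ≠ 0 → v ∈ W := by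
  induction n generalizing d with
  | zero => simp_all [edgeSums]
  | succ n ih =>
    obtain ⟨e, he, a, b, hab, rfl⟩ := hd
    have ha : a ∈ S := hS a (by simp)
    have hb : b ∈ S := hS b (by simp)
    intro v hv
    by_cases hev : e v = 0
    · by_cases hav : a = v
      · exact hav ▸ h hab ha hb
      · by_cases hbv : b = v
        · exact hbv ▸ h hab.symm hb ha
        · simp [hev, hav, hbv] at hv
    · exact ih he (fun w hw => hS w (by simp [hw])) v hev

theorem exists_le_of_mem_edgeIdeal_pow {G : SimpleGraph V} {n : ℕ} {f : MvPolynomial V K}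
    (hf : f ∈ edgeIdeal K G ^ n) {u : V →₀ ℕ} (hu : u ∈ f.support) :
    ∃ d ∈ edgeSums G n, d ≤ u := by
  rw [edgeIdeal_pow_eq_span] at hf
  exact mem_ideal_span_monomial_image.1 hf u hu

theorem X_mul_X_mem_edgeIdeal {G : SimpleGraph V} {u v : V} (h : G.Adj u v) :
    (X u * X v : MvPolynomial V K) ∈ edgeIdeal K G :=
  Ideal.subset_span ⟨u, v, h, rfl⟩

theorem edgeIdeal_inducedOn_le (G : SimpleGraph V) (W : Set V) :
    edgeIdeal K (inducedOn G W) ≤ edgeIdeal K G :=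
  Ideal.span_mono fun _ ⟨u, v, h, hf⟩ => ⟨u, v, G.spanningCoe_induce_le W h, hf⟩

theorem inducedOn_adj {G : SimpleGraph V} {W : Set V} {u v : V} :
    (inducedOn G W).Adj u v ↔ G.Adj u v ∧ u ∈ W ∧ v ∈ W := by
  simp [inducedOn]

/-- Setting the variables of `A` to zero does not change a polynomial modulo the ideal, so the ideal
is the kernel of a map into a domain. -/
theorem varIdeal_isPrime (A : Set V) : (varIdeal K A).IsPrime := by
  classical
  let φ : MvPolynomial V K →ₐ[K] MvPolynomial V K := aeval fun v => if v ∈ A then 0 else X v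
  have hmk : (Ideal.Quotient.mkₐ K (varIdeal K A)).comp φ = Ideal.Quotient.mkₐ K _ := by
    ext v
    by_cases hv : v ∈ A
    · have : (X v : MvPolynomial V K) ∈ varIdeal K A := Ideal.subset_span ⟨v, hv, rfl⟩
      simp [φ, hv, Ideal.Quotient.eq_zero_iff_mem.2 this]
    · simp [φ, hv]
  have : varIdeal K A = RingHom.ker φ := by
    refine le_antisymm (Ideal.span_le.2 ?_) fun f hf => ?_
    · rintro _ ⟨v, hv, rfl⟩
      simp [φ, hv]
    · have h := DFunLike.congr_fun hmk f
      rw [RingHom.mem_ker] at hf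
      rw [AlgHom.comp_apply, hf, map_zero] at h
      exact Ideal.Quotient.eq_zero_iff_mem.1 h.symm
  rw [this]
  exact RingHom.ker_isPrime _

theorem varIdeal_union (A B : Set V) : varIdeal K (A ∪ B) = varIdeal K A ⊔ varIdeal K B := by
  rw [varIdeal, Set.image_union, Ideal.span_union]; rfl

theorem mem_varIdeal {A : Set V} {v : V} (hv : v ∈ A) : (X v : MvPolynomial V K) ∈ varIdeal K A :=
  Ideal.subset_span ⟨v, hv, rfl⟩

/-- A colon ideal of a power of the edge ideal by a monomial is generated by variables as soon
as it contains these variables and no product of the other ones. -/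
theorem varIdeal_eq_colon {G : SimpleGraph V} {n : ℕ} {A : Set V} {m : V →₀ ℕ}
    (hA : ∀ v ∈ A, (X v * monomial m 1 : MvPolynomial V K) ∈ edgeIdeal K G ^ n)
    (hm : ∀ u : V →₀ ℕ, (∀ v ∈ A, u v = 0) → ∀ d ∈ edgeSums G n, ¬ d ≤ u + m) :
    varIdeal K A = (edgeIdeal K G ^ n).colon {monomial m (1 : K)} := by
  refine le_antisymm (Ideal.span_le.2 ?_) fun f hf => ?_
  · rintro _ ⟨v, hv, rfl⟩
    exact Submodule.mem_colon_singleton.2 (hA v hv)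
  · rw [Submodule.mem_colon_singleton, smul_eq_mul] at hf
    refine mem_ideal_span_X_image.2 fun u hu => ?_
    by_contra! hcon
    obtain ⟨d, hd, hdu⟩ := exists_le_of_mem_edgeIdeal_pow hf (u := u + m)
      (by simpa [mem_support_iff] using hu)
    exact hm u hcon d hd hdu

theorem varIdeal_mem_associatedPrimes {I : Ideal (MvPolynomial V K)} {A : Set V}
    {f : MvPolynomial V K} (h : varIdeal K A = I.colon {f}) :
    varIdeal K A ∈ associatedPrimes (MvPolynomial V K) (MvPolynomial V K ⧸ I) := by
  have hprime := varIdeal_isPrime (K := K) A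
  refine ⟨hprime, Ideal.Quotient.mk I f, ?_⟩
  have : varIdeal K A = (⊥ : Submodule (MvPolynomial V K) (MvPolynomial V K ⧸ I)).colon
      {Ideal.Quotient.mk I f} := by
    rw [h]
    ext g
    rw [Submodule.mem_colon_singleton, Submodule.mem_colon_singleton, Submodule.mem_bot,
      smul_eq_mul, ← Ideal.Quotient.eq_zero_iff_mem, map_mul]
    rfl
  rw [← this, hprime.radical]

theorem exists_adj_of_minimal_cover {G : SimpleGraph V} {C : Set V}
    (hC : Minimal G.IsVertexCover C) {w : V} (hw : w ∈ C) : ∃ z, z ∉ C ∧ G.Adj w z := by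
  by_contra! hcon
  have hcov : G.IsVertexCover (C \ {w}) := by
    intro a b hab
    have h1 := hC.1 hab
    have h2 := hcon a
    have h3 := hcon b
    have h4 := hab.symm
    have h5 := hab.ne
    by_cases ha : a = w <;> by_cases hb : b = w <;> grind
  exact (hC.2 hcov Set.sdiff_subset hw).2 rfl

theorem X_notMem_of_ne_zero {p : Ideal (MvPolynomial V K)} {u : V →₀ ℕ} (hu : monomial u (1 : K) ∉ p) {a : V}
    (ha : u a ≠ 0) : (X a : MvPolynomial V K) ∉ p := fun h => hu <| by
  have : Finsupp.single a 1 ≤ u := by simpa [Nat.one_le_iff_ne_zero] using ha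
  rw [← tsub_add_cancel_of_le this, ← mul_one (1 : K), ← monomial_mul]
  exact Ideal.mul_mem_left _ _ h

end Generic

/-! ### Degree-two generators of the localization and neighbors in `p_a`. -/

section Decomposition

variable {K : Type*} [Field K] {V : Type*} {G : SimpleGraph V} {p : Ideal (MvPolynomial V K)}
  [p.IsPrime]

theorem algebraMap_mem_map_of_mul_mem {I : Ideal (MvPolynomial V K)} {f g : MvPolynomial V K}
    (hf : f ∉ p) (h : f * g ∈ I) :
    algebraMap _ (Localization.AtPrime p) g ∈ I.map (algebraMap _ (Localization.AtPrime p)) := by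
  have hu : IsUnit (algebraMap _ (Localization.AtPrime p) f) :=
    IsLocalization.map_units (M := p.primeCompl) _ ⟨f, hf⟩
  have := Ideal.mem_map_of_mem (algebraMap _ (Localization.AtPrime p)) h
  rwa [map_mul, Ideal.unit_mul_mem_iff_mem _ hu] at this

/-- After clearing denominators, some monomial of the denominator lies outside `p`; membership in a
monomial ideal is then tested termwise. -/
theorem exists_mul_monomial_mem {m : V →₀ ℕ}
    (hm : algebraMap _ (Localization.AtPrime p) (monomial m (1 : K)) ∈
      (edgeIdeal K G).map (algebraMap _ (Localization.AtPrime p))) :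
    ∃ u : V →₀ ℕ, monomial u (1 : K) ∉ p ∧ ∃ a b, G.Adj a b ∧
      Finsupp.single a 1 + Finsupp.single b 1 ≤ u + m := by
  obtain ⟨s, hs, hsm⟩ :=
    (IsLocalization.algebraMap_mem_map_algebraMap_iff p.primeCompl _ _ _).1 hm
  obtain ⟨u, hus, hup⟩ : ∃ u ∈ s.support, monomial u (1 : K) ∉ p := by
    by_contra! hcon
    refine hs ?_
    rw [SetLike.mem_coe, s.as_sum]
    refine Ideal.sum_mem _ fun u hu => ?_
    rw [← mul_one (coeff u s), ← C_mul_monomial]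
    exact Ideal.mul_mem_left _ _ (hcon u hu)
  rw [← pow_one (edgeIdeal K G)] at hsm
  obtain ⟨d, ⟨e, he, a, b, hab, rfl⟩, hd⟩ := exists_le_of_mem_edgeIdeal_pow hsm (u := u + m)
    (by simpa [mem_support_iff] using hus)
  obtain rfl : e = 0 := he
  exact ⟨u, hup, a, b, hab, by simpa using hd⟩

/-- Variables outside `p` become units, so such an edge would put `1` or `X b`, a proper divisor of
the generator, in the localized ideal. -/
theorem not_adj_of_isLocalGenerator {m : V →₀ ℕ} (hm : IsLocalGenerator (edgeIdeal K G) p m)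
    (hdeg : m.degree = 2) {a b : V} (hab : G.Adj a b) (ha : (X a : MvPolynomial V K) ∉ p)
    (hb : (X b : MvPolynomial V K) ∉ p ∨ m b ≠ 0) : False := by
  rcases hb with hb | hb
  · have h1 : algebraMap _ (Localization.AtPrime p) (monomial (0 : V →₀ ℕ) (1 : K)) ∈
        (edgeIdeal K G).map (algebraMap _ (Localization.AtPrime p)) :=
      algebraMap_mem_map_of_mul_mem (Ideal.IsPrime.mul_notMem ‹_› ha hb)
        (Ideal.mul_mem_right _ _ (X_mul_X_mem_edgeIdeal hab))
    have h2 := Finsupp.degree_mono (hm.2 h1 zero_le)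
    simp [hdeg] at h2
  · have h1 : algebraMap _ (Localization.AtPrime p) (monomial (Finsupp.single b 1) (1 : K)) ∈
        (edgeIdeal K G).map (algebraMap _ (Localization.AtPrime p)) :=
      algebraMap_mem_map_of_mul_mem ha (X_mul_X_mem_edgeIdeal hab)
    have h2 := Finsupp.degree_mono (hm.2 h1 (by simpa [Nat.one_le_iff_ne_zero] using hb))
    simp [hdeg] at h2

/-- A vertex of `p_a` has a neighbor in `p_a`. -/
theorem exists_adj_partA {x : V} (hx : x ∈ partA G p) : ∃ y ∈ partA G p, G.Adj x y := by
  classical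
  obtain ⟨m, hm, hdeg, hxm⟩ := hx
  obtain ⟨u, hu, a, b, hab, hle⟩ := exists_mul_monomial_mem hm.1
  have key : ∀ a b, G.Adj a b →
      Finsupp.single a 1 + Finsupp.single b 1 ≤ u + m → m a ≠ 0 := by
    intro a b hab hle
    have ha := hle a
    have hb := hle b
    simp only [Finsupp.add_apply, Finsupp.single_eq_same] at ha hb
    have hua : u a = 0 := by
      by_contra hua
      refine not_adj_of_isLocalGenerator hm hdeg hab (X_notMem_of_ne_zero hu hua) ?_
      by_cases hub : u b = 0
      · exact Or.inr (by omega)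
      · exact Or.inl (X_notMem_of_ne_zero hu hub)
    omega
  have hma := key a b hab hle
  have hmb := key b a hab.symm (by rwa [add_comm])
  have haA : a ∈ partA G p := ⟨m, hm, hdeg, by simpa using hma⟩
  have hbA : b ∈ partA G p := ⟨m, hm, hdeg, by simpa using hmb⟩
  -- Otherwise three distinct variables would divide a monomial of degree two.
  have hxab : x = a ∨ x = b := by
    by_contra! hne
    have h3 : Finsupp.single x 1 + (Finsupp.single a 1 + Finsupp.single b 1) ≤ m := by
      intro v
      have := hab.ne
      have : m x ≠ 0 := by simpa using hxm
      simp only [Finsupp.add_apply, Finsupp.single_apply]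
      split_ifs <;> subst_vars <;> first | omega | tauto
    have := Finsupp.degree_mono h3
    simp [hdeg] at this
  rcases hxab with rfl | rfl
  · exact ⟨b, hbA, hab⟩
  · exact ⟨a, haA, hab.symm⟩

theorem exists_partA_adj_of_mem_partOne {x : V} (hx : x ∈ partOne G p) :
    ∃ y ∈ partA G p, G.Adj x y := by
  rcases hx with hx | hx
  · exact exists_adj_partA hx
  · simp only [nbhd, Set.mem_iUnion, SimpleGraph.mem_neighborSet] at hx
    obtain ⟨y, hy, hyx⟩ := hx
    exact ⟨y, hy, hyx.symm⟩

theorem neighbor_mem_partOne {a b : V} (ha : a ∈ partA G p) (hab : G.Adj a b) :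
    b ∈ partOne G p :=
  Or.inr (Set.mem_biUnion ha hab)

end Decomposition

end BuildOutward

/-! ### The colon ideal realizing the new associated prime. -/

open MvPolynomial in
theorem mainTheorem6 {K : Type*} [Field K] {V : Type*} [Finite V] (G : SimpleGraph V) (t : ℕ)
    (p : Ideal (MvPolynomial V K)) [p.IsPrime]
    (hp : p ∈ associatedPrimes (MvPolynomial V K)
      (MvPolynomial V K ⧸ BuildOutward.edgeIdeal K G ^ t))
    (c : V →₀ ℕ) (hc : (c.support : Set V) ⊆ BuildOutward.partA G p)
    (hdeg : c.degree + 1 ≤ 2 * t)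
    (hp₁ : BuildOutward.varIdeal K (BuildOutward.partOne G p) =
      (BuildOutward.edgeIdeal K (BuildOutward.graphOne G p) ^ t).colon
        {MvPolynomial.monomial c (1 : K)})
    (x : V) (hx : x ∈ BuildOutward.partOne G p)
    (p₁' : Set V) (hp₁' : p₁' = BuildOutward.partOne G p ∪ G.neighborSet x)
    (p₂' : Set V) (hp₂' : Minimal (BuildOutward.inducedOn G p₁'ᶜ).IsVertexCover p₂') :
    BuildOutward.varIdeal K p₁' ⊔ BuildOutward.varIdeal K p₂' ∈
      associatedPrimes (MvPolynomial V K)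
        (MvPolynomial V K ⧸ BuildOutward.edgeIdeal K G ^ (t + 1)) := by
  classical
  obtain ⟨y, hy, hxy⟩ := BuildOutward.exists_partA_adj_of_mem_partOne hx
  have hy₁ : y ∈ BuildOutward.partOne G p := Or.inl hy
  set P : Set V := p₁' ∪ p₂' with hP
  have hcP : ∀ {w : V}, w ∈ BuildOutward.partOne G p →
      (X w * monomial c 1 : MvPolynomial V K) ∈ BuildOutward.edgeIdeal K G ^ t := by
    intro w hw
    have hw := BuildOutward.mem_varIdeal (K := K) hw
    rw [hp₁, Submodule.mem_colon_singleton] at hw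
    exact Ideal.pow_right_mono (BuildOutward.edgeIdeal_inducedOn_le _ _) t hw
  let M : V →₀ ℕ := Finsupp.equivFunOnFinite.symm fun v => if v ∈ P then 0 else 1
  have hM : ∀ v ∈ P, M v = 0 := fun v hv => by simp [M, hv]
  have hM' : ∀ v, v ∉ P → Finsupp.single v 1 ≤ M := fun v hv => by simp [M, hv]
  let b : V →₀ ℕ := c + (Finsupp.single x 1 + Finsupp.single y 1)
  have hmono : (monomial (b + M) 1 : MvPolynomial V K) =
      monomial c 1 * (X x * X y) * monomial M 1 := by
    simp [b, X, monomial_mul]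
  rw [← BuildOutward.varIdeal_union]
  refine BuildOutward.varIdeal_mem_associatedPrimes (f := monomial (b + M) 1)
    (BuildOutward.varIdeal_eq_colon ?_ ?_)
  · intro w hw
    rw [hmono]
    rcases hw with hw | hw
    · rw [hp₁'] at hw
      rcases hw with hw | hw
      · have h := Ideal.mul_mem_right (monomial M 1) _
          (Ideal.mul_mem_mul (hcP hw) (BuildOutward.X_mul_X_mem_edgeIdeal (K := K) hxy))
        rw [pow_succ]
        convert h using 1
        ring
      · have h := Ideal.mul_mem_right (monomial M 1) _
          (Ideal.mul_mem_mul (hcP hy₁) (BuildOutward.X_mul_X_mem_edgeIdeal (K := K) hw))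
        rw [pow_succ]
        convert h using 1
        ring
    · obtain ⟨z, hz, hwz⟩ := BuildOutward.exists_adj_of_minimal_cover hp₂' hw
      -- The neighbor `z` lies outside `P`, so it divides `M` and supplies the extra edge `wz`.
      obtain ⟨hwz, -, hzp⟩ := BuildOutward.inducedOn_adj.1 hwz
      have hzP : z ∉ P := fun h => h.elim hzp hz
      have hMz : (monomial M 1 : MvPolynomial V K) =
          monomial (M - Finsupp.single z 1) 1 * X z := by
        rw [X, monomial_mul, tsub_add_cancel_of_le (hM' z hzP), mul_one]
      have h := Ideal.mul_mem_right (X x * monomial (M - Finsupp.single z 1) 1) _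
        (Ideal.mul_mem_mul (hcP hy₁) (BuildOutward.X_mul_X_mem_edgeIdeal (K := K) hwz))
      rw [pow_succ, hMz]
      convert h using 1
      ring
  · intro u hu d hd hle
    have hbx : ∀ v, b v ≠ 0 → v = x ∨ v ∈ BuildOutward.partA G p := by
      intro v hv
      by_contra! hcon
      have h1 : c v = 0 := by
        by_contra h
        exact hcon.2 (hc (by simpa using h))
      have h2 : y ≠ v := fun h => hcon.2 (h ▸ hy)
      exact hv (by simp [b, h1, hcon.1.symm, h2])
    have hbN : ∀ v w, b v ≠ 0 → G.Adj v w → w ∈ P := by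
      intro v w hv hvw
      left
      rw [hp₁']
      rcases hbx v hv with rfl | hv
      · exact Or.inr hvw
      · exact Or.inl (BuildOutward.neighbor_mem_partOne hv hvw)
    have hbP : ∀ v, b v ≠ 0 → v ∈ P := by
      intro v hv
      left
      rw [hp₁']
      rcases hbx v hv with rfl | hv
      · exact Or.inl hx
      · exact Or.inl (Or.inl hv)
    -- Edges with both ends in `supp b ∪ Pᶜ` stay in `supp b`: none leads from `supp b` to `Pᶜ`, and
    -- the cover `p₂'` excludes edges inside `Pᶜ`.
    have hW := BuildOutward.support_subset_of_mem_edgeSums (G := G)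
      (S := {v | b v ≠ 0} ∪ Pᶜ) (W := {v | b v ≠ 0}) (by
        rintro v w hvw (hv | hv) hw
        · exact hv
        · exfalso
          rcases hw with hw | hw
          · exact hv (hbN w v hw hvw.symm)
          · have := hp₂'.1 (BuildOutward.inducedOn_adj.2
              ⟨hvw, fun h => hv (Or.inl h), fun h => hw (Or.inl h)⟩)
            exact this.elim (fun h => hv (Or.inr h)) (fun h => hw (Or.inr h))) hd (by
        intro v hv
        by_cases hvP : v ∈ P
        · left
          have := hle v
          simp only [Finsupp.add_apply, hu v hvP, hM v hvP] at this
          simp only [Set.mem_ofPred_eq]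
          omega
        · exact Or.inr hvP)
    have hdb : d ≤ b := by
      intro v
      by_cases hv : d v = 0
      · simp [hv]
      · have := hle v
        have hvP := hbP v (hW v hv)
        simpa [hu v hvP, hM v hvP] using this
    have h1 := Finsupp.degree_mono hdb
    rw [BuildOutward.degree_of_mem_edgeSums hd] at h1
    simp only [b, map_add, Finsupp.degree_single] at h1
    omega
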